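/- Let $\sigma,r,b>0$ and consider the classical Lorenz system $$\dot x=\sigma(y-x),\qquad \dot y=rx-y-xz,\qquad \dot z=-bz+xy .$$ Write it as $\dot{\mathbf x}=f(\mathbf x)$ in $\mathbb R^3$ with solution $\mathbf x(t,x_0)$, $\mathbf x(0,x_0)=x_0$, let $J=\partial f/\partial\mathbf x$, and let $X(t,x_0)$ be the solution of $\dot X=J(\mathbf x(t,x_0))X$, $X(0,x_0)=I$. For $t>0$ let $\mathrm{LE}_i(t,x_0)=\frac1t\ln\sigma_i(X(t,x_0))$, $i=1,2,3$, where $\sigma_1\ge\sigma_2\ge\sigma_3>0$ are the singular values. Put $\mathrm{LD}(t,x_0)=0$ if $\mathrm{LE}_1(t,x_0)\le0$; $\mathrm{LD}(t,x_0)=3$ if $\sum_{i=1}^3\mathrm{LE}_i(t,x_0)\ge0$ (and $\mathrm{LE}_1(t,x_0)>0$); and otherwise $$\mathrm{LD}(t,x_0)=j+\frac{\mathrm{LE}_1(t,x_0)+\dots+\mathrm{LE}_j(t,x_0)}{|\mathrm{LE}_{j+1}(t,x_0)|},$$ where $j$ is the largest index with $\mathrm{LE}_1(t,x_0)+\dots+\mathrm{LE}_j(t,x_0)>0$.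 The Lyapunov dimension of an invariant compact set $K$ is $\dim_LK=\sup_{x_0\in K}\limsup_{t\to+\infty}\mathrm{LD}(t,x_0)$. Let $K$ be a global attractor of the system, i.e. a nonempty bounded closed set that is invariant ($\mathbf x(t,K)=K$ for all $t\ge0$) and globally attractive ($\operatorname{dist}(\mathbf x(t,x_0),K)\to0$ as $t\to+\infty$ for every $x_0\in\mathbb R^3$). Assume that $$r-1>0,\qquad r-1\ge\frac{b(b+\sigma-1)^2-4\sigma(b+\sigma b-b^2)}{3\sigma^2},$$ and that one of the following two conditions holds: (a) $\sigma^2(r-1)(b-4)\le4\sigma(\sigma b+b-b^2)-b(b+\sigma-1)^2$; (b) $\sigma^2(r-1)(b-4)>4\sigma(\sigma b+b-b^2)-b(b+\sigma-1)^2$, and the quadratic equation in $\gamma$ $$(2\sigma-b+\gamma)^2\bigl(b(b+\sigma-1)^2-4\sigma(\sigma b+b-b^2)+\sigma^2(r-1)(b-4)\bigr)+4b\gamma(\sigma+1)\bigl(b(b+\sigma-1)^2-4\sigma(\sigma b+b-b^2)-3\sigma^2(r-1)\bigr)=0$$ has two distinct real roots, the greater of which is positive. If $\sigma r>(b+1)(b+\sigma)$,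 then $$\dim_LK=3-\frac{2(\sigma+b+1)}{\sigma+1+\sqrt{(\sigma-1)^2+4\sigma r}} .$$ -/

import Mathlib

open Set Filter Topology

/-! ### Autonomous systems `u' = f(u)` on `ℝⁿ`: solutions, fundamental matrices, attractors -/

/-- `u` solves `u' = f(u)` on `[0, ∞)` (one-sided derivative at `0`). -/
def IsForwardSolution {n : ℕ} (f : EuclideanSpace ℝ (Fin n) → EuclideanSpace ℝ (Fin n))
    (u : ℝ → EuclideanSpace ℝ (Fin n)) : Prop :=
  ∀ t : ℝ, 0 ≤ t → HasDerivWithinAt u (f (u t)) (Ici 0) t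

/-- `X` is the fundamental matrix `X(t, x₀)`, normalized by `X(0, x₀) = I`, of the linearized
system along the solution `u` that starts at `x₀`: it satisfies the variational equation
`X' = J(u(t)) X` on `[0, ∞)`, where `J = fderiv ℝ f` is the Jacobian of `f`. Matrices are treated
as linear maps of Euclidean space. -/
def IsFundamentalMatrix {n : ℕ} (f : EuclideanSpace ℝ (Fin n) → EuclideanSpace ℝ (Fin n))
    (x₀ : EuclideanSpace ℝ (Fin n))
    (X : ℝ → EuclideanSpace ℝ (Fin n) →L[ℝ] EuclideanSpace ℝ (Fin n)) : Prop :=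
  ∃ u : ℝ → EuclideanSpace ℝ (Fin n), IsForwardSolution f u ∧ u 0 = x₀ ∧
    X 0 = ContinuousLinearMap.id ℝ (EuclideanSpace ℝ (Fin n)) ∧
    ∀ t : ℝ, 0 ≤ t → HasDerivWithinAt X ((fderiv ℝ f (u t)).comp (X t)) (Ici 0) t

/-- A global attractor: a (nonempty) bounded closed set which is invariant, that is, the time-`t`
map sends `K` onto `K` for every `t ≥ 0`, and which is globally attractive. Attraction is required
for each solution separately, so that sets which attract bounded sets uniformly are included. -/
structure IsGlobalAttractor {n : ℕ} (f : EuclideanSpace ℝ (Fin n) → EuclideanSpace ℝ (Fin n))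
    (K : Set (EuclideanSpace ℝ (Fin n))) : Prop where
  nonempty : K.Nonempty
  bounded : Bornology.IsBounded K
  closed : IsClosed K
  invariant : ∀ t : ℝ, 0 ≤ t → {y | ∃ u, IsForwardSolution f u ∧ u 0 ∈ K ∧ u t = y} = K
  attractive : ∀ u, IsForwardSolution f u → Tendsto (fun t => Metric.infDist (u t) K) atTop (𝓝 0)

/-! ### Lyapunov dimension -/

/-- The Lyapunov exponent functions `LEᵢ(t) = (1/t) ln σᵢ(A)` of `A = X(t, x₀)`, where
`σ₁ ≥ σ₂ ≥ ⋯` are the singular values; the index starts at `0`. -/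
noncomputable def lyapunovExponentFn {n : ℕ} (t : ℝ)
    (A : EuclideanSpace ℝ (Fin n) →L[ℝ] EuclideanSpace ℝ (Fin n)) (i : ℕ) : ℝ :=
  1 / t * Real.log ((A : EuclideanSpace ℝ (Fin n) →ₗ[ℝ] EuclideanSpace ℝ (Fin n)).singularValues i)

/-- The Kaplan-Yorke formula for a decreasing sequence `ℓ 0 ≥ ⋯ ≥ ℓ (n - 1)`: the value is `0` if
`ℓ 0 ≤ 0`, it is `n` if the whole sum is nonnegative, and otherwise
`j + (ℓ 0 + ⋯ + ℓ (j - 1)) / |ℓ j|`, where `j` is the largest index with `ℓ 0 + ⋯ + ℓ (j - 1) > 0`.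
In the last case `ℓ 0 + ⋯ + ℓ j ≤ 0`, so `ℓ j < 0` and the quotient lies in `(0, 1]`. -/
noncomputable def kaplanYorke (n : ℕ) (ℓ : ℕ → ℝ) : ℝ :=
  open Classical in
  if ℓ 0 ≤ 0 then 0
  else if 0 ≤ ∑ i ∈ Finset.range n, ℓ i then n
  else
    let j := Nat.findGreatest (fun k => 0 < ∑ i ∈ Finset.range k, ℓ i) n
    j + (∑ i ∈ Finset.range j, ℓ i) / |ℓ j|

/-- The local Lyapunov dimension `LD(x₀) = limsup_{t → ∞} LD(t, x₀)`. For a smooth `f` the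
fundamental matrix is unique on `[0, ∞)`, so that the supremum over `X` only names its value. -/
noncomputable def localLyapunovDim {n : ℕ}
    (f : EuclideanSpace ℝ (Fin n) → EuclideanSpace ℝ (Fin n))
    (x₀ : EuclideanSpace ℝ (Fin n)) : EReal :=
  ⨆ (X : ℝ → EuclideanSpace ℝ (Fin n) →L[ℝ] EuclideanSpace ℝ (Fin n))
    (_ : IsFundamentalMatrix f x₀ X),
    limsup (fun t : ℝ => ((kaplanYorke n (lyapunovExponentFn t (X t)) : ℝ) : EReal)) atTop

/-- The Lyapunov dimension `dim_L K = sup_{x₀ ∈ K} LD(x₀)`. -/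
noncomputable def lyapunovDim {n : ℕ}
    (f : EuclideanSpace ℝ (Fin n) → EuclideanSpace ℝ (Fin n))
    (K : Set (EuclideanSpace ℝ (Fin n))) : EReal :=
  ⨆ x₀ ∈ K, localLyapunovDim f x₀

/-! ### The Lorenz system -/

/-- The right-hand side of the classical Lorenz system. -/
noncomputable def lorenzField (σ r b : ℝ) (p : EuclideanSpace ℝ (Fin 3)) :
    EuclideanSpace ℝ (Fin 3) :=
  !₂[σ * (p 1 - p 0), r * p 0 - p 1 - p 0 * p 2, -b * p 2 + p 0 * p 1]

/-- The left-hand side of the quadratic equation in `γ`. -/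
def gammaPoly (σ r b γ : ℝ) : ℝ :=
  (2 * σ - b + γ) ^ 2 *
      (b * (b + σ - 1) ^ 2 - 4 * σ * (σ * b + b - b ^ 2) + σ ^ 2 * (r - 1) * (b - 4)) +
    4 * b * γ * (σ + 1) *
      (b * (b + σ - 1) ^ 2 - 4 * σ * (σ * b + b - b ^ 2) - 3 * σ ^ 2 * (r - 1))

/-!
Since the trace of the Jacobian is the constant `-(σ + b + 1)`, Liouville's formula fixes the sum of
the Lyapunov exponents, and the Kaplan-Yorke formula depends only on the lowest one: it reads
`3 - (σ + b + 1) / Λ` when that exponent is `-Λ`. At the origin the value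
`Λ = (σ + 1 + √((σ - 1) ^ 2 + 4 * σ * r)) / 2` is attained, because `-Λ` is an eigenvalue of the
Jacobian there.

For the upper bound it remains to show that no solution of the variational equation contracts
faster than at the rate `Λ`. In a linear change of variables that symmetrizes the Jacobian at the
origin, the lowest eigenvalue of the symmetric part of the Jacobian at `p` is at least `-Λ` up to an
error term in `p`. That term is absorbed by the derivative along the flow of a quartic Lyapunov
function (Leonov's method), and this changes the norm only by bounded factors because solutions are
bounded. With the undetermined coefficients chosen suitably, the derivative plus the error is minus
a sum of three weighted squares; the weights can be made nonnegative as soon as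
`gammaPoly σ r b γ ≤ 0` for some `γ > 0`.
-/

open Module

/-! ### A comparison principle on a half-line -/

theorem mul_exp_sub_le_of_hasDerivWithinAt {f f' φ φ' : ℝ → ℝ} {a : ℝ}
    (hf : ∀ t, a ≤ t → HasDerivWithinAt f (f' t) (Ici a) t)
    (hφ : ∀ t, a ≤ t → HasDerivWithinAt φ (φ' t) (Ici a) t)
    (h : ∀ t, a ≤ t → φ' t * f t ≤ f' t) {t : ℝ} (ht : a ≤ t) :
    f a * Real.exp (φ t - φ a) ≤ f t := by
  have hderiv (τ : ℝ) (hτ : a ≤ τ) := (hf τ hτ).mul (hφ τ hτ).neg.exp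
  have hmono : MonotoneOn (fun τ => f τ * Real.exp (-φ τ)) (Ici a) := by
    refine monotoneOn_of_hasDerivWithinAt_nonneg (convex_Ici a)
      (fun τ hτ => (hderiv τ hτ).continuousWithinAt)
      (fun τ hτ => (hderiv τ (interior_subset hτ)).mono interior_subset) fun τ hτ => ?_
    have := mul_nonneg (sub_nonneg.2 (h τ (interior_subset hτ))) (Real.exp_pos (-φ τ)).le
    simp only [Pi.neg_apply]
    linarith
  calc f a * Real.exp (φ t - φ a) = f a * Real.exp (-φ a) * Real.exp (φ t) := by
        rw [mul_assoc, ← Real.exp_add, neg_add_eq_sub]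
    _ ≤ f t * Real.exp (-φ t) * Real.exp (φ t) :=
        mul_le_mul_of_nonneg_right (hmono self_mem_Ici ht ht) (Real.exp_pos _).le
    _ = f t := by rw [mul_assoc, ← Real.exp_add, neg_add_cancel, Real.exp_zero, mul_one]

theorem eq_mul_exp_sub_of_hasDerivWithinAt {f φ φ' : ℝ → ℝ} {a : ℝ}
    (hf : ∀ t, a ≤ t → HasDerivWithinAt f (φ' t * f t) (Ici a) t)
    (hφ : ∀ t, a ≤ t → HasDerivWithinAt φ (φ' t) (Ici a) t) {t : ℝ} (ht : a ≤ t) :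
    f t = f a * Real.exp (φ t - φ a) := by
  refine le_antisymm ?_ (mul_exp_sub_le_of_hasDerivWithinAt hf hφ (fun _ _ => le_rfl) ht)
  have := mul_exp_sub_le_of_hasDerivWithinAt (fun τ hτ => (hf τ hτ).neg) hφ
    (fun τ _ => (mul_neg (φ' τ) (f τ)).le) ht
  simp only [Pi.neg_apply, neg_mul] at this
  exact neg_le_neg_iff.1 this

theorem le_max_div_of_hasDerivWithinAt {f f' : ℝ → ℝ} {a c d : ℝ} (hc : 0 < c)
    (hf : ∀ t, a ≤ t → HasDerivWithinAt f (f' t) (Ici a) t)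
    (h : ∀ t, a ≤ t → f' t ≤ d - c * f t) {t : ℝ} (ht : a ≤ t) :
    f t ≤ max (f a) (d / c) := by
  have hexp := mul_exp_sub_le_of_hasDerivWithinAt (f := fun τ => d / c - f τ) (φ := fun τ => -c * τ)
    (fun τ hτ => (hf τ hτ).const_sub (d / c))
    (fun τ _ => ((hasDerivAt_id τ).const_mul (-c)).hasDerivWithinAt)
    (fun τ hτ => by
      have : c * (d / c) = d := by field_simp
      linarith [h τ hτ]) ht
  have hexp_le : Real.exp (-c * t - -c * a) ≤ 1 := by
    rw [Real.exp_le_one_iff]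
    nlinarith
  rcases le_total (f a) (d / c) with hfa | hfa
  · refine le_max_of_le_right ?_
    have := mul_nonneg (sub_nonneg.2 hfa) (Real.exp_pos (-c * t - -c * a)).le
    linarith
  · refine le_max_of_le_left ?_
    have := mul_le_mul_of_nonpos_left hexp_le (sub_nonpos.2 hfa)
    linarith

/-! ### Liouville's formula -/

section Liouville

variable {𝕜 : Type*} [NontriviallyNormedField 𝕜]

theorem hasDerivWithinAt_matrix_det {ι : Type*} [Fintype ι] [DecidableEq ι]
    {M : 𝕜 → Matrix ι ι 𝕜} {A : Matrix ι ι 𝕜} {s : Set 𝕜} {t : 𝕜}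
    (hM : HasDerivWithinAt M (A * M t) s t) :
    HasDerivWithinAt (fun τ => (M τ).det) (A.trace * (M t).det) s t := by
  let detRows : ContinuousMultilinearMap 𝕜 (fun _ : ι => ι → 𝕜) 𝕜 :=
    ⟨Matrix.detRowAlternating.toMultilinearMap, continuous_id.matrix_det⟩
  have hrow (i : ι) : HasDerivWithinAt (fun τ => M τ i) (∑ k, A i k • M t k) s t := by
    have h : (A * M t) i = ∑ k, A i k • M t k := by
      ext j
      simp [Matrix.mul_apply]
    exact h ▸ hasDerivWithinAt_pi.1 hM i
  refine (HasFDerivWithinAt.multilinear_comp detRows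
    fun i => (hrow i).hasFDerivWithinAt).hasDerivWithinAt.congr_deriv ?_
  rw [sum_apply, Matrix.trace, Finset.sum_mul]
  refine Finset.sum_congr rfl fun i _ => ?_
  rw [ContinuousLinearMap.comp_apply, ContinuousLinearMap.toSpanSingleton_apply, one_smul]
  exact Matrix.det_updateRow_sum (M t) i (A i)

theorem hasDerivWithinAt_det_comp [CompleteSpace 𝕜] {E : Type*} [NormedAddCommGroup E]
    [NormedSpace 𝕜 E] [FiniteDimensional 𝕜 E] {X : 𝕜 → E →L[𝕜] E} {A : E →L[𝕜] E} {s : Set 𝕜}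
    {t : 𝕜} (hX : HasDerivWithinAt X (A ∘L X t) s t) :
    HasDerivWithinAt (fun τ => (X τ).det) (LinearMap.trace 𝕜 E A * (X t).det) s t := by
  let e := finBasis 𝕜 E
  have hmatrix : HasDerivWithinAt (fun τ => LinearMap.toMatrix e e (X τ))
      (LinearMap.toMatrix e e A * LinearMap.toMatrix e e (X t)) s t := by
    rw [← LinearMap.toMatrix_comp]
    refine hasDerivWithinAt_pi.2 fun i => hasDerivWithinAt_pi.2 fun j => ?_
    simpa [LinearMap.toMatrix_apply, Function.comp_def] using
      (e.coord i).toContinuousLinearMap.hasFDerivAt.comp_hasDerivWithinAt t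
        (hX.clm_apply (hasDerivWithinAt_const t s (e j)))
  simpa only [LinearMap.det_toMatrix, ← LinearMap.trace_eq_matrix_trace] using
    hasDerivWithinAt_matrix_det hmatrix

theorem det_eq_exp_of_hasDerivWithinAt {E : Type*} [NormedAddCommGroup E] [NormedSpace ℝ E]
    [FiniteDimensional ℝ E] {X A : ℝ → E →L[ℝ] E} {τ : ℝ} (hX0 : X 0 = ContinuousLinearMap.id ℝ E)
    (hX : ∀ t, 0 ≤ t → HasDerivWithinAt X (A t ∘L X t) (Ici 0) t)
    (hA : ∀ t, 0 ≤ t → LinearMap.trace ℝ E (A t) = τ) {t : ℝ} (ht : 0 ≤ t) :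
    (X t).det = Real.exp (τ * t) := by
  have h := eq_mul_exp_sub_of_hasDerivWithinAt (φ := fun s => τ * s) (φ' := fun _ => τ)
    (fun s hs => hA s hs ▸ hasDerivWithinAt_det_comp (hX s hs))
    (fun s _ => by simpa using ((hasDerivAt_id s).const_mul τ).hasDerivWithinAt) ht
  simpa [hX0, ContinuousLinearMap.det] using h

end Liouville

/-! ### Singular values -/

section SingularValues

variable {E F : Type*} [NormedAddCommGroup E] [InnerProductSpace ℝ E] [FiniteDimensional ℝ E]
  [NormedAddCommGroup F] [InnerProductSpace ℝ F] [FiniteDimensional ℝ F]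

theorem norm_apply_eigenvectorBasis_eq_singularValues (T : E →ₗ[ℝ] F) {n : ℕ}
    (hn : finrank ℝ E = n) (i : Fin n) :
    ‖T (T.isSymmetric_adjoint_comp_self.eigenvectorBasis hn i)‖ = T.singularValues i := by
  set e := T.isSymmetric_adjoint_comp_self.eigenvectorBasis hn with he
  have heigen : T.adjoint (T (e i)) = T.singularValues i ^ 2 • e i := by
    rw [← LinearMap.comp_apply, he, T.isSymmetric_adjoint_comp_self.apply_eigenvectorBasis hn,
      T.sq_singularValues_fin hn, RCLike.ofReal_real_eq_id, id_eq]
  have hsq : ‖T (e i)‖ ^ 2 = T.singularValues i ^ 2 := by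
    rw [← real_inner_self_eq_norm_sq, ← T.adjoint_inner_left, heigen, real_inner_smul_left,
      real_inner_self_eq_norm_sq, e.norm_eq_one, one_pow, mul_one]
  exact (sq_eq_sq₀ (norm_nonneg _) (T.singularValues_nonneg _)).1 hsq

theorem le_singularValues_of_forall_le_norm {T : E →ₗ[ℝ] F} {c : ℝ}
    (hT : ∀ v, c * ‖v‖ ≤ ‖T v‖) {i : ℕ} (hi : i < finrank ℝ E) : c ≤ T.singularValues i := by
  have h := hT (T.isSymmetric_adjoint_comp_self.eigenvectorBasis rfl ⟨i, hi⟩)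
  rwa [norm_apply_eigenvectorBasis_eq_singularValues T rfl ⟨i, hi⟩, OrthonormalBasis.norm_eq_one,
    mul_one] at h

theorem norm_apply_sq_eq_sum_singularValues (T : E →ₗ[ℝ] F) {n : ℕ} (hn : finrank ℝ E = n)
    (v : E) :
    ‖T v‖ ^ 2 = ∑ i : Fin n, T.singularValues i ^ 2 *
      inner ℝ (T.isSymmetric_adjoint_comp_self.eigenvectorBasis hn i) v ^ 2 := by
  set e := T.isSymmetric_adjoint_comp_self.eigenvectorBasis hn with he
  rw [← real_inner_self_eq_norm_sq, ← T.adjoint_inner_left, ← LinearMap.comp_apply,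
    ← e.sum_inner_mul_inner]
  refine Finset.sum_congr rfl fun i _ => ?_
  rw [T.isSymmetric_adjoint_comp_self v (e i), he,
    T.isSymmetric_adjoint_comp_self.apply_eigenvectorBasis hn, ← T.sq_singularValues_fin hn,
    RCLike.ofReal_real_eq_id, id_eq, real_inner_smul_right, real_inner_comm v]
  ring

theorem singularValues_mul_norm_le (T : E →ₗ[ℝ] F) {n : ℕ} (hn : finrank ℝ E = n + 1) (v : E) :
    T.singularValues n * ‖v‖ ≤ ‖T v‖ := by
  refine le_of_sq_le_sq ?_ (norm_nonneg _)
  rw [mul_pow, norm_apply_sq_eq_sum_singularValues T hn,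
    ← (T.isSymmetric_adjoint_comp_self.eigenvectorBasis hn).sum_sq_norm_inner_right,
    Finset.mul_sum]
  refine Finset.sum_le_sum fun i _ => ?_
  rw [Real.norm_eq_abs, sq_abs]
  gcongr
  · exact T.singularValues_nonneg _
  · exact T.singularValues_antitone (Nat.lt_succ_iff.1 i.2)

theorem prod_singularValues_eq_abs_det (T : E →ₗ[ℝ] E) :
    ∏ i ∈ Finset.range (finrank ℝ E), T.singularValues i = |LinearMap.det T| := by
  rw [← LinearMap.normDet_eq_prod_singularValues, LinearMap.normDet_eq_abs_det]

theorem singularValues_pos_of_det_ne_zero {T : E →ₗ[ℝ] E} (hT : LinearMap.det T ≠ 0) {i : ℕ}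
    (hi : i < finrank ℝ E) : 0 < T.singularValues i := by
  refine (T.singularValues_nonneg i).lt_of_ne' fun h => hT ?_
  rw [← abs_eq_zero, ← prod_singularValues_eq_abs_det]
  exact Finset.prod_eq_zero (Finset.mem_range.2 hi) h

end SingularValues

/-! ### The Kaplan-Yorke formula -/

section KaplanYorke

variable {n : ℕ} {ℓ : ℕ → ℝ} {T : ℝ}

theorem pos_of_sum_range_pos (hℓ : ∀ i < n, ℓ i ≤ ℓ 0) (hn : 0 < ∑ i ∈ Finset.range n, ℓ i) :
    0 < ℓ 0 := by
  by_contra! h₀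
  exact hn.not_ge (Finset.sum_nonpos fun i hi => (hℓ i (Finset.mem_range.1 hi)).trans h₀)

theorem kaplanYorke_succ_le (hn : ∑ i ∈ Finset.range n, ℓ i ≤ 0)
    (hsucc : ∑ i ∈ Finset.range (n + 1), ℓ i < 0) : kaplanYorke (n + 1) ℓ ≤ n := by
  classical
  rw [kaplanYorke]
  split_ifs with h₀ hS
  · exact n.cast_nonneg
  · exact absurd hsucc hS.not_gt
  set P : ℕ → Prop := fun k => 0 < ∑ i ∈ Finset.range k, ℓ i
  set j := Nat.findGreatest P (n + 1)
  have hPj : P j := Nat.findGreatest_spec (m := 1) (by omega) (by simpa [P] using h₀)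
  have hjn : j < n := by
    have hj : j ≤ n + 1 := Nat.findGreatest_le _
    have hj_n : j ≠ n := fun h => hn.not_gt (h ▸ hPj)
    have hj_succ : j ≠ n + 1 := fun h => hsucc.not_gt (h ▸ hPj)
    omega
  have hPj_succ : ¬ P (j + 1) := Nat.findGreatest_is_greatest j.lt_succ_self (by omega)
  have hquot : (∑ i ∈ Finset.range j, ℓ i) / |ℓ j| ≤ 1 := by
    simp only [P, Finset.sum_range_succ, not_lt] at hPj hPj_succ
    exact div_le_one_of_le₀ (by linarith [neg_le_abs (ℓ j)]) (abs_nonneg _)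
  have hj1 : (j : ℝ) + 1 ≤ n := by exact_mod_cast hjn
  exact (add_le_add_right hquot _).trans hj1

theorem kaplanYorke_succ_eq (h₀ : 0 < ℓ 0) (hn : 0 < ∑ i ∈ Finset.range n, ℓ i)
    (hT : 0 < T) (hsucc : ∑ i ∈ Finset.range (n + 1), ℓ i = -T) :
    kaplanYorke (n + 1) ℓ = n + 1 - T / -ℓ n := by
  classical
  have hneg : ∑ i ∈ Finset.range (n + 1), ℓ i < 0 := by linarith
  rw [kaplanYorke, if_neg h₀.not_ge, if_neg hneg.not_ge, Nat.findGreatest_of_not hneg.not_gt,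
    Nat.findGreatest_eq hn]
  rw [Finset.sum_range_succ] at hsucc
  have hℓn : ℓ n < 0 := by linarith
  have hsum : ∑ i ∈ Finset.range n, ℓ i = -ℓ n - T := by linarith
  simp only [abs_of_neg hℓn, hsum]
  rw [sub_div, div_self (neg_pos.2 hℓn).ne', add_sub_assoc]

theorem kaplanYorke_succ_le_max {M : ℝ} (hℓ : ∀ i < n, ℓ i ≤ ℓ 0) (hT : 0 < T)
    (hsucc : ∑ i ∈ Finset.range (n + 1), ℓ i = -T) (hM : -M ≤ ℓ n) :
    kaplanYorke (n + 1) ℓ ≤ max (n : ℝ) (n + 1 - T / M) := by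
  rcases le_or_gt (∑ i ∈ Finset.range n, ℓ i) 0 with hn | hn
  · exact le_max_of_le_left (kaplanYorke_succ_le hn (by linarith))
  · rw [kaplanYorke_succ_eq (pos_of_sum_range_pos hℓ hn) hn hT hsucc]
    rw [Finset.sum_range_succ] at hsucc
    refine le_max_of_le_right (sub_le_sub_left ?_ _)
    gcongr <;> linarith

theorem le_kaplanYorke_succ {L : ℝ} (hℓ : ∀ i < n, ℓ i ≤ ℓ 0) (hT : 0 < T)
    (hsucc : ∑ i ∈ Finset.range (n + 1), ℓ i = -T) (hTL : T < L) (hL : ℓ n ≤ -L) :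
    n + 1 - T / L ≤ kaplanYorke (n + 1) ℓ := by
  have hn : 0 < ∑ i ∈ Finset.range n, ℓ i := by
    rw [Finset.sum_range_succ] at hsucc
    linarith
  rw [kaplanYorke_succ_eq (pos_of_sum_range_pos hℓ hn) hn hT hsucc]
  gcongr <;> linarith

end KaplanYorke

/-! ### Finite-time Lyapunov exponents -/

section LyapunovExponents

theorem lyapunovExponentFn_le_of_le {n : ℕ} {t : ℝ} (ht : 0 < t)
    {A : EuclideanSpace ℝ (Fin n) →L[ℝ] EuclideanSpace ℝ (Fin n)} (hA : A.det ≠ 0) {i j : ℕ}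
    (hij : i ≤ j) (hj : j < n) : lyapunovExponentFn t A j ≤ lyapunovExponentFn t A i := by
  have hpos : 0 < A.toLinearMap.singularValues j :=
    singularValues_pos_of_det_ne_zero hA (by simpa using hj)
  unfold lyapunovExponentFn
  gcongr
  exact LinearMap.singularValues_antitone _ hij

theorem sum_lyapunovExponentFn {n : ℕ} (t : ℝ)
    {A : EuclideanSpace ℝ (Fin n) →L[ℝ] EuclideanSpace ℝ (Fin n)} (hA : A.det ≠ 0) :
    ∑ i ∈ Finset.range n, lyapunovExponentFn t A i = Real.log |A.det| / t := by
  have hprod := prod_singularValues_eq_abs_det A.toLinearMap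
  rw [finrank_euclideanSpace_fin] at hprod
  have hne (i : ℕ) (hi : i ∈ Finset.range n) :
      A.toLinearMap.singularValues i ≠ 0 :=
    (singularValues_pos_of_det_ne_zero hA (by simpa using hi)).ne'
  simp only [lyapunovExponentFn]
  rw [← Finset.mul_sum, ← Real.log_prod hne, hprod, one_div_mul_eq_div]

theorem sum_lyapunovExponentFn_of_det_eq_exp {n : ℕ} {t τ : ℝ} (ht : t ≠ 0)
    {A : EuclideanSpace ℝ (Fin n) →L[ℝ] EuclideanSpace ℝ (Fin n)}
    (hA : A.det = Real.exp (τ * t)) : ∑ i ∈ Finset.range n, lyapunovExponentFn t A i = τ := by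
  rw [sum_lyapunovExponentFn t (hA ▸ (Real.exp_pos _).ne'), hA, Real.abs_exp, Real.log_exp,
    mul_div_cancel_right₀ _ ht]

theorem log_div_le_lyapunovExponentFn {n : ℕ} {t : ℝ} (ht : 0 < t)
    {A : EuclideanSpace ℝ (Fin n) →L[ℝ] EuclideanSpace ℝ (Fin n)} {c : ℝ} (hc : 0 < c)
    (hA : ∀ v, c * ‖v‖ ≤ ‖A v‖) {i : ℕ} (hi : i < n) :
    Real.log c / t ≤ lyapunovExponentFn t A i := by
  rw [lyapunovExponentFn, one_div_mul_eq_div]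
  gcongr
  exact le_singularValues_of_forall_le_norm hA (by simpa using hi)

theorem lyapunovExponentFn_le_log_div {n : ℕ} {t : ℝ} (ht : 0 < t)
    {A : EuclideanSpace ℝ (Fin (n + 1)) →L[ℝ] EuclideanSpace ℝ (Fin (n + 1))} (hA : A.det ≠ 0)
    {c : ℝ} {v : EuclideanSpace ℝ (Fin (n + 1))} (hv : v ≠ 0) (hAv : ‖A v‖ ≤ c * ‖v‖) :
    lyapunovExponentFn t A n ≤ Real.log c / t := by
  have hpos : 0 < A.toLinearMap.singularValues n :=
    singularValues_pos_of_det_ne_zero hA (by simp)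
  rw [lyapunovExponentFn, one_div_mul_eq_div]
  gcongr
  refine le_of_mul_le_mul_right ?_ (norm_pos_iff.2 hv)
  exact (singularValues_mul_norm_le _ (by simp) v).trans hAv

end LyapunovExponents

/-! ### Bounds for the local Lyapunov dimension -/

section LocalLyapunovDim

variable {n : ℕ} {f : EuclideanSpace ℝ (Fin (n + 1)) → EuclideanSpace ℝ (Fin (n + 1))} {T Λ : ℝ}

theorem kaplanYorke_lyapunovExponentFn_le_max (hT : 0 < T) {c t : ℝ} (ht : 0 < t) (hc : 0 < c)
    {A : EuclideanSpace ℝ (Fin (n + 1)) →L[ℝ] EuclideanSpace ℝ (Fin (n + 1))}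
    (hdet : A.det = Real.exp (-T * t)) (hA : ∀ v, c * Real.exp (-Λ * t) * ‖v‖ ≤ ‖A v‖) :
    kaplanYorke (n + 1) (lyapunovExponentFn t A) ≤
      max (n : ℝ) (n + 1 - T / (Λ - Real.log c / t)) := by
  have hdet0 : A.det ≠ 0 := hdet ▸ (Real.exp_pos _).ne'
  refine kaplanYorke_succ_le_max
    (fun i hi => lyapunovExponentFn_le_of_le ht hdet0 i.zero_le (by omega)) hT
    (sum_lyapunovExponentFn_of_det_eq_exp ht.ne' hdet) ?_
  refine le_of_eq_of_le ?_
    (log_div_le_lyapunovExponentFn ht (by positivity) hA n.lt_succ_self)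
  rw [Real.log_mul hc.ne' (Real.exp_pos _).ne', Real.log_exp, add_div,
    mul_div_cancel_right₀ _ ht.ne']
  ring

theorem localLyapunovDim_le {x₀ : EuclideanSpace ℝ (Fin (n + 1))} (hT : 0 < T) (hTΛ : T ≤ Λ)
    (htrace : ∀ p, LinearMap.trace ℝ (EuclideanSpace ℝ (Fin (n + 1))) (fderiv ℝ f p) = -T)
    (hbound : ∀ X, IsFundamentalMatrix f x₀ X →
      ∃ c > 0, ∀ t, 0 ≤ t → ∀ v, c * Real.exp (-Λ * t) * ‖v‖ ≤ ‖X t v‖) :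
    localLyapunovDim f x₀ ≤ ((n + 1 - T / Λ : ℝ) : EReal) := by
  refine iSup₂_le fun X hX => ?_
  obtain ⟨c, hc, hcX⟩ := hbound X hX
  obtain ⟨u, -, -, hX0, hX'⟩ := hX
  have hΛ : 0 < Λ := hT.trans_le hTΛ
  have hlim : Tendsto (fun t : ℝ => max (n : ℝ) (n + 1 - T / (Λ - Real.log c / t))) atTop
      (𝓝 (n + 1 - T / Λ)) := by
    have hrate : Tendsto (fun t : ℝ => Λ - Real.log c / t) atTop (𝓝 Λ) := by
      simpa using (tendsto_const_nhds.div_atTop tendsto_id).const_sub Λ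
    have hmax : max (n : ℝ) (n + 1 - T / Λ) = n + 1 - T / Λ := by
      refine max_eq_right ?_
      linarith [(div_le_one hΛ).2 hTΛ]
    exact hmax ▸ tendsto_const_nhds.max ((tendsto_const_nhds.div hrate hΛ.ne').const_sub _)
  rw [← ((continuous_coe_real_ereal.tendsto _).comp hlim).limsup_eq]
  refine limsup_le_limsup ?_
  filter_upwards [eventually_gt_atTop 0] with t ht
  rw [Function.comp_apply, EReal.coe_le_coe_iff]
  exact kaplanYorke_lyapunovExponentFn_le_max hT ht hc
    (det_eq_exp_of_hasDerivWithinAt hX0 hX' (fun s _ => htrace (u s)) ht.le) (hcX t ht.le)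

theorem exp_apply_of_apply_eq_smul {𝕜 E : Type*} [RCLike 𝕜] [NormedAddCommGroup E]
    [NormedSpace 𝕜 E] [CompleteSpace E] {A : E →L[𝕜] E} {μ : 𝕜} {v : E} (h : A v = μ • v) :
    NormedSpace.exp A v = NormedSpace.exp μ • v := by
  have hpow (k : ℕ) : (A ^ k) v = μ ^ k • v := by
    induction k with
    | zero => simp
    | succ k ih => rw [pow_succ', mul_apply_eq_comp, ih, map_smul, h, smul_smul, pow_succ]
  have hA := (NormedSpace.exp_series_hasSum_exp' (𝕂 := 𝕜) A).mapL
    (ContinuousLinearMap.apply 𝕜 E v)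
  have hμ := (NormedSpace.exp_series_hasSum_exp' (𝕂 := 𝕜) μ).smul_const v
  refine hA.unique ?_
  simpa [hpow, smul_smul] using hμ

theorem exp_zero_smul {E : Type*} [NormedAddCommGroup E] [NormedSpace ℝ E] (A : E →L[ℝ] E) :
    NormedSpace.exp ((0 : ℝ) • A) = ContinuousLinearMap.id ℝ E :=
  (congrArg NormedSpace.exp (zero_smul ℝ A)).trans NormedSpace.exp_zero

theorem isFundamentalMatrix_exp {n : ℕ}
    {f : EuclideanSpace ℝ (Fin n) → EuclideanSpace ℝ (Fin n)} {p : EuclideanSpace ℝ (Fin n)}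
    (hp : f p = 0) : IsFundamentalMatrix f p fun t => NormedSpace.exp (t • fderiv ℝ f p) :=
  ⟨fun _ => p, fun t _ => hp ▸ hasDerivWithinAt_const t _ p, rfl, exp_zero_smul _,
    fun t _ => (hasDerivAt_exp_smul_const' (fderiv ℝ f p) t).hasDerivWithinAt⟩

theorem le_localLyapunovDim_of_eigenvector {p v : EuclideanSpace ℝ (Fin (n + 1))} (hp : f p = 0)
    (hT : 0 < T) (hTΛ : T < Λ)
    (htrace : LinearMap.trace ℝ (EuclideanSpace ℝ (Fin (n + 1))) (fderiv ℝ f p) = -T)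
    (hv : v ≠ 0) (heigen : fderiv ℝ f p v = -Λ • v) :
    ((n + 1 - T / Λ : ℝ) : EReal) ≤ localLyapunovDim f p := by
  set X : ℝ → EuclideanSpace ℝ (Fin (n + 1)) →L[ℝ] EuclideanSpace ℝ (Fin (n + 1)) :=
    fun t => NormedSpace.exp (t • fderiv ℝ f p)
  refine le_trans ?_ (le_iSup₂ (α := EReal) X (isFundamentalMatrix_exp hp))
  refine le_limsup_of_frequently_le (Eventually.frequently ?_)
  filter_upwards [eventually_gt_atTop 0] with t ht
  rw [EReal.coe_le_coe_iff]
  have hdet : (X t).det = Real.exp (-T * t) :=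
    det_eq_exp_of_hasDerivWithinAt (A := fun _ => fderiv ℝ f p) (exp_zero_smul _)
      (fun s _ => (hasDerivAt_exp_smul_const' (fderiv ℝ f p) s).hasDerivWithinAt)
      (fun _ _ => htrace) ht.le
  have hdet0 : (X t).det ≠ 0 := hdet ▸ (Real.exp_pos _).ne'
  have hXv : ‖X t v‖ = Real.exp (-Λ * t) * ‖v‖ := by
    have h : (t • fderiv ℝ f p) v = (-Λ * t) • v := by
      rw [smul_apply, heigen, smul_smul, mul_comm]
    rw [exp_apply_of_apply_eq_smul h, ← Real.exp_eq_exp_ℝ, norm_smul,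
      Real.norm_of_nonneg (Real.exp_pos _).le]
  refine le_kaplanYorke_succ
    (fun i hi => lyapunovExponentFn_le_of_le ht hdet0 i.zero_le (by omega)) hT
    (sum_lyapunovExponentFn_of_det_eq_exp ht.ne' hdet) hTΛ ?_
  simpa [neg_div, ht.ne'] using lyapunovExponentFn_le_log_div ht hdet0 hv hXv.le

end LocalLyapunovDim

/-! ### Lower growth bounds for the variational equation -/

section VariationalEquation

variable {n : ℕ} {f : EuclideanSpace ℝ (Fin n) → EuclideanSpace ℝ (Fin n)}
  {u : ℝ → EuclideanSpace ℝ (Fin n)}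

theorem IsForwardSolution.norm_sub_sq_le (hu : IsForwardSolution f u)
    {p : EuclideanSpace ℝ (Fin n)} {c d : ℝ} (hc : 0 < c)
    (hf : ∀ x, 2 * inner ℝ (x - p) (f x) ≤ d - c * ‖x - p‖ ^ 2) {t : ℝ} (ht : 0 ≤ t) :
    ‖u t - p‖ ^ 2 ≤ max (‖u 0 - p‖ ^ 2) (d / c) :=
  le_max_div_of_hasDerivWithinAt hc (fun s hs => ((hu s hs).sub_const p).norm_sq)
    (fun s _ => hf (u s)) ht

theorem IsForwardSolution.isBounded_image (hu : IsForwardSolution f u)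
    {p : EuclideanSpace ℝ (Fin n)} {c d : ℝ} (hc : 0 < c)
    (hf : ∀ x, 2 * inner ℝ (x - p) (f x) ≤ d - c * ‖x - p‖ ^ 2) :
    Bornology.IsBounded (u '' Ici 0) := by
  refine (Metric.isBounded_closedBall (x := p)
    (r := √(max (‖u 0 - p‖ ^ 2) (d / c)))).subset (image_subset_iff.2 fun t ht => ?_)
  rw [mem_preimage, mem_closedBall_iff_norm]
  exact Real.le_sqrt_of_sq_le (hu.norm_sub_sq_le hc hf ht)

theorem norm_sq_mul_exp_le_norm_sq_of_variational {F : Type*} [NormedAddCommGroup F]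
    [InnerProductSpace ℝ F] (hu : IsForwardSolution f u)
    {w : ℝ → EuclideanSpace ℝ (Fin n)}
    (hw : ∀ t, 0 ≤ t → HasDerivWithinAt w (fderiv ℝ f (u t) (w t)) (Ici 0) t)
    {V : EuclideanSpace ℝ (Fin n) → ℝ} (hV : Differentiable ℝ V)
    {S : EuclideanSpace ℝ (Fin n) →L[ℝ] F} {Λ : ℝ}
    (hS : ∀ p v, (-(2 * Λ) + fderiv ℝ V p (f p)) * ‖S v‖ ^ 2 ≤
      2 * inner ℝ (S v) (S (fderiv ℝ f p v))) {t : ℝ} (ht : 0 ≤ t) :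
    ‖S (w 0)‖ ^ 2 * Real.exp (-(2 * Λ) * t + (V (u t) - V (u 0))) ≤ ‖S (w t)‖ ^ 2 := by
  have hgrowth := mul_exp_sub_le_of_hasDerivWithinAt
    (φ := fun s => -(2 * Λ) * s + V (u s))
    (φ' := fun s => -(2 * Λ) + fderiv ℝ V (u s) (f (u s)))
    (fun s hs => (S.hasFDerivAt.comp_hasDerivWithinAt s (hw s hs)).norm_sq)
    (fun s hs => by
      simpa using! ((hasDerivWithinAt_id s (Ici 0)).const_mul (-(2 * Λ))).add
        ((hV (u s)).hasFDerivAt.comp_hasDerivWithinAt s (hu s hs)))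
    (fun s _ => hS (u s) (w s)) ht
  simpa [add_sub_assoc] using hgrowth

theorem IsFundamentalMatrix.exists_exp_mul_norm_le {F : Type*} [NormedAddCommGroup F]
    [InnerProductSpace ℝ F] {x₀ : EuclideanSpace ℝ (Fin n)}
    {X : ℝ → EuclideanSpace ℝ (Fin n) →L[ℝ] EuclideanSpace ℝ (Fin n)}
    (hX : IsFundamentalMatrix f x₀ X)
    (hbdd : ∀ u, IsForwardSolution f u → Bornology.IsBounded (u '' Ici 0))
    {V : EuclideanSpace ℝ (Fin n) → ℝ} (hV : Differentiable ℝ V)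
    {S : EuclideanSpace ℝ (Fin n) →L[ℝ] F} (hSinj : Function.Injective S) {Λ : ℝ}
    (hS : ∀ p v, (-(2 * Λ) + fderiv ℝ V p (f p)) * ‖S v‖ ^ 2 ≤
      2 * inner ℝ (S v) (S (fderiv ℝ f p v))) :
    ∃ c > 0, ∀ t, 0 ≤ t → ∀ v, c * Real.exp (-Λ * t) * ‖v‖ ≤ ‖X t v‖ := by
  obtain ⟨u, hu, -, hX0, hX'⟩ := hX
  obtain ⟨C, hC⟩ : ∃ C, ∀ t, 0 ≤ t → |V (u t)| ≤ C := by
    obtain ⟨C, hC⟩ := (hbdd u hu).isCompact_closure.exists_bound_of_continuousOn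
      hV.continuous.continuousOn
    exact ⟨C, fun t ht => hC _ (subset_closure (mem_image_of_mem u ht))⟩
  obtain ⟨k, hk, hSk⟩ := S.toLinearMap.exists_antilipschitzWith (LinearMap.ker_eq_bot.2 hSinj)
  refine ⟨Real.exp (-C) / (k * (‖S‖ + 1)), by positivity, fun t ht v => ?_⟩
  have hgrowth : ‖S v‖ * Real.exp (-Λ * t - C) ≤ ‖S (X t v)‖ := by
    have h := norm_sq_mul_exp_le_norm_sq_of_variational (w := fun s => X s v) hu
      (fun s hs => by simpa using (hX' s hs).clm_apply (hasDerivWithinAt_const s _ v)) hV hS ht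
    refine le_of_sq_le_sq (le_trans ?_ h) (norm_nonneg _)
    rw [mul_pow, ← Real.exp_nat_mul, hX0, ContinuousLinearMap.id_apply]
    gcongr
    push_cast
    linarith [neg_le_of_abs_le (hC t ht), le_of_abs_le (hC 0 le_rfl)]
  have hlower : ‖v‖ ≤ k * ‖S v‖ := by simpa using hSk.le_mul_dist v 0
  have hupper : ‖S (X t v)‖ ≤ (‖S‖ + 1) * ‖X t v‖ := S.le_of_opNorm_le (by linarith) _
  rw [div_mul_eq_mul_div, div_mul_eq_mul_div, div_le_iff₀ (by positivity)]
  calc Real.exp (-C) * Real.exp (-Λ * t) * ‖v‖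
      = Real.exp (-Λ * t - C) * ‖v‖ := by rw [← Real.exp_add]; ring_nf
    _ ≤ Real.exp (-Λ * t - C) * (k * ‖S v‖) := by gcongr
    _ = k * (‖S v‖ * Real.exp (-Λ * t - C)) := by ring
    _ ≤ k * ((‖S‖ + 1) * ‖X t v‖) := mul_le_mul_of_nonneg_left (hgrowth.trans hupper) k.2
    _ = ‖X t v‖ * (k * (‖S‖ + 1)) := by ring

end VariationalEquation

/-! ### The Lorenz vector field -/

/-- The Jacobian of the Lorenz field at `p`. -/
noncomputable def lorenzJacobian (σ r b : ℝ) (p : EuclideanSpace ℝ (Fin 3)) :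
    EuclideanSpace ℝ (Fin 3) →L[ℝ] EuclideanSpace ℝ (Fin 3) :=
  Matrix.toEuclideanCLM (𝕜 := ℝ) !![-σ, σ, 0; r - p 2, -1, -p 0; p 1, p 0, -b]

theorem lorenzJacobian_apply (σ r b : ℝ) (p v : EuclideanSpace ℝ (Fin 3)) :
    lorenzJacobian σ r b p v = !₂[-σ * v 0 + σ * v 1, (r - p 2) * v 0 - v 1 - p 0 * v 2,
      p 1 * v 0 + p 0 * v 1 - b * v 2] := by
  ext i
  fin_cases i <;> simp [lorenzJacobian, Matrix.mulVec, dotProduct, Fin.sum_univ_three] <;> ring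

theorem hasFDerivAt_euclidean_apply {n : ℕ} (p : EuclideanSpace ℝ (Fin n)) (i : Fin n) :
    HasFDerivAt (fun q : EuclideanSpace ℝ (Fin n) => q i) (EuclideanSpace.proj (𝕜 := ℝ) i) p :=
  (EuclideanSpace.proj (𝕜 := ℝ) i).hasFDerivAt

theorem hasFDerivAt_lorenzField (σ r b : ℝ) (p : EuclideanSpace ℝ (Fin 3)) :
    HasFDerivAt (lorenzField σ r b) (lorenzJacobian σ r b p) p := by
  rw [← hasFDerivWithinAt_univ, hasFDerivWithinAt_euclidean]
  intro i
  rw [hasFDerivWithinAt_univ]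
  have hx := hasFDerivAt_euclidean_apply p 0
  have hy := hasFDerivAt_euclidean_apply p 1
  have hz := hasFDerivAt_euclidean_apply p 2
  fin_cases i
  · refine ((hy.sub hx).const_mul σ).congr_fderiv ?_
    ext v
    simp only [Fin.isValue, smul_apply, sub_apply, PiLp.proj_apply, smul_eq_mul, Fin.zero_eta,
      ContinuousLinearMap.comp_apply, lorenzJacobian_apply, neg_mul, Matrix.cons_val_zero]
    ring
  · refine (((hx.const_mul r).sub hy).sub (hx.mul hz)).congr_fderiv ?_
    ext v
    simp only [Fin.isValue, sub_apply, smul_apply, PiLp.proj_apply, smul_eq_mul, add_apply,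
      Fin.mk_one, ContinuousLinearMap.comp_apply, lorenzJacobian_apply, Matrix.cons_val_one,
      Matrix.cons_val_zero]
    ring
  · refine ((hz.const_mul (-b)).add (hx.mul hy)).congr_fderiv ?_
    ext v
    simp only [Fin.isValue, neg_smul, add_apply, neg_apply, smul_apply, PiLp.proj_apply,
      smul_eq_mul, Fin.reduceFinMk, ContinuousLinearMap.comp_apply, lorenzJacobian_apply,
      Matrix.cons_val]
    ring

theorem trace_lorenzJacobian (σ r b : ℝ) (p : EuclideanSpace ℝ (Fin 3)) :
    LinearMap.trace ℝ (EuclideanSpace ℝ (Fin 3)) (lorenzJacobian σ r b p) = -(σ + b + 1) := by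
  rw [lorenzJacobian, Matrix.coe_toEuclideanCLM_eq_toEuclideanLin,
    Matrix.toEuclideanLin_eq_toLin_orthonormal, Matrix.trace_toLin_eq, Matrix.trace_fin_three]
  simp
  ring

theorem lorenzField_zero (σ r b : ℝ) : lorenzField σ r b 0 = 0 := by
  ext i
  fin_cases i <;> simp [lorenzField]

theorem exists_eigenvector_lorenzJacobian_zero {σ r : ℝ} (b : ℝ) {Λ : ℝ} (hσ : σ ≠ 0)
    (hΛ : Λ ^ 2 - (σ + 1) * Λ + σ - r * σ = 0) :
    ∃ v, v ≠ 0 ∧ lorenzJacobian σ r b 0 v = -Λ • v := by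
  refine ⟨!₂[σ, σ - Λ, 0], fun h => hσ ?_, ?_⟩
  · simpa using congrArg (fun v : EuclideanSpace ℝ (Fin 3) => v 0) h
  · rw [lorenzJacobian_apply]
    ext i
    fin_cases i
    · simp only [Fin.isValue, Matrix.cons_val, Fin.zero_eta, PiLp.smul_apply, smul_eq_mul]
      ring
    · simp only [Fin.isValue, Matrix.cons_val, PiLp.zero_apply, Fin.mk_one, PiLp.smul_apply,
        smul_eq_mul]
      linear_combination -hΛ
    · simp

theorem isBounded_image_of_isForwardSolution_lorenzField {σ r b : ℝ} (hσ : 0 < σ) (hb : 0 < b)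
    {u : ℝ → EuclideanSpace ℝ (Fin 3)} (hu : IsForwardSolution (lorenzField σ r b) u) :
    Bornology.IsBounded (u '' Ici 0) := by
  have hc : 0 < min (min (2 * σ) 2) b := by positivity
  refine hu.isBounded_image (p := !₂[0, 0, σ + r]) (d := b * (σ + r) ^ 2) hc fun x => ?_
  have h₀ : min (min (2 * σ) 2) b ≤ 2 * σ := (min_le_left _ _).trans (min_le_left _ _)
  have h₁ : min (min (2 * σ) 2) b ≤ 2 := (min_le_left _ _).trans (min_le_right _ _)
  have h₂ : min (min (2 * σ) 2) b ≤ b := min_le_right _ _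
  simp only [lorenzField, EuclideanSpace.real_norm_sq_eq, PiLp.inner_apply, PiLp.sub_apply,
    RCLike.inner_apply, Real.ringHom_apply, Fin.sum_univ_three, Fin.isValue, Matrix.cons_val]
  nlinarith [mul_le_mul_of_nonneg_right h₀ (sq_nonneg (x 0)),
    mul_le_mul_of_nonneg_right h₁ (sq_nonneg (x 1)),
    mul_le_mul_of_nonneg_right h₂ (sq_nonneg (x 2 - (σ + r))), mul_nonneg hb.le (sq_nonneg (x 2))]

/-! ### Symmetrizing the Lorenz Jacobian -/

/-- The square of the factor by which `lorenzSymmetrizer` rescales the first coordinate. -/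
noncomputable def lorenzScaleSq (σ r b : ℝ) : ℝ :=
  (σ * r + (b - 1) * (σ - b)) / σ ^ 2

/-- The change of variables that makes the Jacobian of the Lorenz system at the origin symmetric;
its norm is the metric in which the growth of solutions of the variational equation is measured. -/
noncomputable def lorenzSymmetrizer (σ r b : ℝ) :
    EuclideanSpace ℝ (Fin 3) →L[ℝ] EuclideanSpace ℝ (Fin 3) :=
  Matrix.toEuclideanCLM (𝕜 := ℝ) !![√(lorenzScaleSq σ r b), 0, 0; -((b - 1) / σ), 1, 0; 0, 0, 1]

/-- The gap between the two eigenvalues of the Jacobian of the Lorenz system at the origin that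
belong to the plane `z = 0`. -/
noncomputable def lorenzGap (σ r : ℝ) : ℝ :=
  √((σ - 1) ^ 2 + 4 * σ * r)

/-- The amount by which the squared gap between the extreme eigenvalues of the symmetric part of the
Jacobian at `p`, conjugated by `lorenzSymmetrizer`, exceeds its value `lorenzGap σ r ^ 2` at the
origin, multiplied by `lorenzScaleSq σ r b`; the Lyapunov function has to compensate for it. -/
noncomputable def lorenzExcess (σ r b : ℝ) (p : EuclideanSpace ℝ (Fin 3)) : ℝ :=
  p 2 ^ 2 - 4 * σ * lorenzScaleSq σ r b * p 2 + (p 1 + (b - 1) / σ * p 0) ^ 2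

theorem lorenzSymmetrizer_apply (σ r b : ℝ) (v : EuclideanSpace ℝ (Fin 3)) :
    lorenzSymmetrizer σ r b v =
      !₂[√(lorenzScaleSq σ r b) * v 0, v 1 - (b - 1) / σ * v 0, v 2] := by
  ext i
  fin_cases i <;>
    simp [lorenzSymmetrizer, Matrix.mulVec, dotProduct, Fin.sum_univ_three]
  ring

theorem lorenzSymmetrizer_injective {σ r b : ℝ} (hκ : 0 < lorenzScaleSq σ r b) :
    Function.Injective (lorenzSymmetrizer σ r b) := by
  refine (injective_iff_map_eq_zero _).2 fun v hv => ?_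
  rw [lorenzSymmetrizer_apply] at hv
  have h (i : Fin 3) := congrArg (fun w : EuclideanSpace ℝ (Fin 3) => w i) hv
  have h₀ : v 0 = 0 := by simpa [(Real.sqrt_pos.2 hκ).ne'] using h 0
  have h₁ : v 1 = 0 := by simpa [h₀] using h 1
  have h₂ : v 2 = 0 := by simpa using h 2
  ext i
  fin_cases i <;> simp [h₀, h₁, h₂]

theorem two_mul_inner_lorenzSymmetrizer_lorenzJacobian {σ r b : ℝ} (hσ : σ ≠ 0)
    (hκ : 0 < lorenzScaleSq σ r b) (p v : EuclideanSpace ℝ (Fin 3)) {w : EuclideanSpace ℝ (Fin 3)}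
    (hw : lorenzSymmetrizer σ r b v = w) :
    2 * inner ℝ w (lorenzSymmetrizer σ r b (lorenzJacobian σ r b p v)) =
      -(σ + 1) * ‖w‖ ^ 2 + (σ + 1 - 2 * b) * (w 1 ^ 2 + w 2 ^ 2 - w 0 ^ 2) +
        2 * w 0 * ((2 * σ * lorenzScaleSq σ r b - p 2) / √(lorenzScaleSq σ r b) * w 1 +
          (p 1 + (b - 1) / σ * p 0) / √(lorenzScaleSq σ r b) * w 2) := by
  subst hw
  have hr : σ * r = σ ^ 2 * lorenzScaleSq σ r b - (b - 1) * (σ - b) := by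
    rw [lorenzScaleSq]
    field_simp
    ring
  obtain ⟨ρ, hρ, hρκ⟩ : ∃ ρ, 0 < ρ ∧ lorenzScaleSq σ r b = ρ ^ 2 :=
    ⟨_, Real.sqrt_pos.2 hκ, (Real.sq_sqrt hκ.le).symm⟩
  obtain rfl : r = (σ ^ 2 * ρ ^ 2 - (b - 1) * (σ - b)) / σ := by
    rw [eq_div_iff hσ, mul_comm, hr, hρκ]
  simp only [lorenzSymmetrizer_apply, lorenzJacobian_apply, EuclideanSpace.real_norm_sq_eq,
    Fin.sum_univ_three, PiLp.inner_apply, RCLike.inner_apply, Real.ringHom_apply, hρκ,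
    Real.sqrt_sq hρ.le, Fin.isValue, Matrix.cons_val]
  field_simp
  ring

theorem neg_mul_sum_sq_le_of_sq_add_sq_add_sq_le {h B C N : ℝ} (hN : 0 ≤ N)
    (hle : h ^ 2 + B ^ 2 + C ^ 2 ≤ N ^ 2) (p s q : ℝ) :
    -N * (p ^ 2 + s ^ 2 + q ^ 2) ≤
      h * (s ^ 2 + q ^ 2 - p ^ 2) + 2 * p * (B * s + C * q) := by
  refine neg_mul N _ ▸ (abs_le.1 (abs_le_of_sq_le_sq ?_ (by positivity))).1
  calc (h * (s ^ 2 + q ^ 2 - p ^ 2) + 2 * p * (B * s + C * q)) ^ 2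
      ≤ (h ^ 2 + B ^ 2 + C ^ 2) *
          ((s ^ 2 + q ^ 2 - p ^ 2) ^ 2 + (2 * p * s) ^ 2 + (2 * p * q) ^ 2) := by
        nlinarith [sq_nonneg (h * (2 * p * s) - B * (s ^ 2 + q ^ 2 - p ^ 2)),
          sq_nonneg (h * (2 * p * q) - C * (s ^ 2 + q ^ 2 - p ^ 2)),
          sq_nonneg (B * (2 * p * q) - C * (2 * p * s))]
    _ = (h ^ 2 + B ^ 2 + C ^ 2) * (p ^ 2 + s ^ 2 + q ^ 2) ^ 2 := by ring
    _ ≤ N ^ 2 * (p ^ 2 + s ^ 2 + q ^ 2) ^ 2 := by gcongr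
    _ = (N * (p ^ 2 + s ^ 2 + q ^ 2)) ^ 2 := by ring

theorem add_div_two_mul_nonneg_and_le_sq {G W : ℝ} (hG : 0 < G) (hGW : 0 ≤ G ^ 2 + W) :
    0 ≤ G + W / (2 * G) ∧ G ^ 2 + W ≤ (G + W / (2 * G)) ^ 2 := by
  constructor
  · have hmean : G + W / (2 * G) = (G ^ 2 + (G ^ 2 + W)) / (2 * G) := by
      field_simp
      ring
    rw [hmean]
    positivity
  · have hexpand : (G + W / (2 * G)) ^ 2 = G ^ 2 + W + (W / (2 * G)) ^ 2 := by
      field_simp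
      ring
    linarith [sq_nonneg (W / (2 * G))]

theorem sq_lorenzGap {σ r : ℝ} (hG : 0 < lorenzGap σ r) :
    lorenzGap σ r ^ 2 = (σ - 1) ^ 2 + 4 * σ * r :=
  Real.sq_sqrt (Real.sqrt_pos.1 hG).le

theorem sq_lorenzGap_add_lorenzExcess_div {σ r b : ℝ} (hσ : σ ≠ 0)
    (hκ : 0 < lorenzScaleSq σ r b) (hG : 0 < lorenzGap σ r) (p : EuclideanSpace ℝ (Fin 3)) :
    lorenzGap σ r ^ 2 + lorenzExcess σ r b p / lorenzScaleSq σ r b =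
      (σ + 1 - 2 * b) ^ 2 +
        ((2 * σ * lorenzScaleSq σ r b - p 2) / √(lorenzScaleSq σ r b)) ^ 2 +
        ((p 1 + (b - 1) / σ * p 0) / √(lorenzScaleSq σ r b)) ^ 2 := by
  have hκσ : σ ^ 2 * lorenzScaleSq σ r b = σ * r + (b - 1) * (σ - b) := by
    rw [lorenzScaleSq]
    field_simp
  rw [div_pow, div_pow, Real.sq_sqrt hκ.le, sq_lorenzGap hG, lorenzExcess]
  field_simp
  linear_combination -(4 * σ ^ 2 * lorenzScaleSq σ r b) * hκσ

theorem neg_mul_norm_sq_le_inner_lorenzSymmetrizer {σ r b : ℝ} (hσ : σ ≠ 0)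
    (hκ : 0 < lorenzScaleSq σ r b) (hG : 0 < lorenzGap σ r) (p v : EuclideanSpace ℝ (Fin 3)) :
    -(σ + 1 + lorenzGap σ r + lorenzExcess σ r b p / (2 * lorenzGap σ r * lorenzScaleSq σ r b)) *
        ‖lorenzSymmetrizer σ r b v‖ ^ 2 ≤
      2 * inner ℝ (lorenzSymmetrizer σ r b v)
        (lorenzSymmetrizer σ r b (lorenzJacobian σ r b p v)) := by
  set w := lorenzSymmetrizer σ r b v with hw
  have hgap := sq_lorenzGap_add_lorenzExcess_div hσ hκ hG p
  have hnonneg :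
      0 ≤ lorenzGap σ r ^ 2 + lorenzExcess σ r b p / lorenzScaleSq σ r b := by
    rw [hgap]
    positivity
  obtain ⟨hN, htangent⟩ := add_div_two_mul_nonneg_and_le_sq hG hnonneg
  have hform := neg_mul_sum_sq_le_of_sq_add_sq_add_sq_le hN (hgap.symm.trans_le htangent)
    (w 0) (w 1) (w 2)
  have hnorm : ‖w‖ ^ 2 = w 0 ^ 2 + w 1 ^ 2 + w 2 ^ 2 := by
    rw [EuclideanSpace.real_norm_sq_eq, Fin.sum_univ_three]
  rw [← hnorm, div_div, mul_comm (lorenzScaleSq σ r b)] at hform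
  rw [two_mul_inner_lorenzSymmetrizer_lorenzJacobian hσ hκ p v hw.symm]
  linarith

/-! ### The Lyapunov function -/

/-- The quartic ansatz for the Lyapunov function; the coefficients of `z ^ 2` and `x ^ 4` are those
for which the monomials `x * y * z` and `x ^ 3 * y` cancel in the derivative along the flow. -/
noncomputable def lorenzLyapunov (σ c₁ c₂ c₃ c₄ g : ℝ) (p : EuclideanSpace ℝ (Fin 3)) : ℝ :=
  c₁ * p 2 + c₂ * p 0 ^ 2 + c₃ * p 1 ^ 2 + (c₃ + σ * g) * p 2 ^ 2 + c₄ * (p 0 * p 1) -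
    g * (p 0 ^ 2 * p 2) + g / (4 * σ) * p 0 ^ 4

theorem differentiable_lorenzLyapunov (σ c₁ c₂ c₃ c₄ g : ℝ) :
    Differentiable ℝ (lorenzLyapunov σ c₁ c₂ c₃ c₄ g) := by
  unfold lorenzLyapunov
  fun_prop

theorem fderiv_lorenzLyapunov_lorenzField {σ : ℝ} (hσ : σ ≠ 0) (r b c₁ c₂ c₃ c₄ g : ℝ)
    (p : EuclideanSpace ℝ (Fin 3)) :
    fderiv ℝ (lorenzLyapunov σ c₁ c₂ c₃ c₄ g) p (lorenzField σ r b p) =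
      -b * c₁ * p 2 + (c₁ + 2 * σ * c₂ + 2 * r * c₃ - (σ + 1) * c₄) * (p 0 * p 1) +
        (r * c₄ - 2 * σ * c₂) * p 0 ^ 2 + (σ * c₄ - 2 * c₃) * p 1 ^ 2 -
        2 * b * (c₃ + σ * g) * p 2 ^ 2 + ((2 * σ + b) * g - c₄) * (p 0 ^ 2 * p 2) -
        g * p 0 ^ 4 := by
  have hx := hasFDerivAt_euclidean_apply p 0
  have hy := hasFDerivAt_euclidean_apply p 1
  have hz := hasFDerivAt_euclidean_apply p 2
  have hV : HasFDerivAt (lorenzLyapunov σ c₁ c₂ c₃ c₄ g) _ p :=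
    (((((((hz.const_mul c₁).add ((hx.pow 2).const_mul c₂)).add ((hy.pow 2).const_mul c₃)).add
      ((hz.pow 2).const_mul (c₃ + σ * g))).add ((hx.mul hy).const_mul c₄)).sub
      (((hx.pow 2).mul hz).const_mul g)).add ((hx.pow 4).const_mul (g / (4 * σ))))
  rw [hV.fderiv]
  simp only [Fin.isValue, Nat.add_one_sub_one, pow_one, nsmul_eq_mul, Nat.cast_ofNat, smul_add,
    lorenzField, add_apply, sub_apply, smul_apply, PiLp.proj_apply, Matrix.cons_val, smul_eq_mul]
  field_simp
  ring

theorem exists_lorenzLyapunov_coeff {σ b γ m : ℝ} (hσ : 0 < σ + 1) (hγ : 0 < γ)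
    (h : (2 * σ - b + γ) ^ 2 * (1 - m) ≤ 4 * γ * (σ + 1) * (b * m - 1)) (hm : 1 ≤ b * m) :
    ∃ g, 0 ≤ g ∧ 1 - m ≤ (σ + 1) * γ * g ∧ g * (2 * σ - b + γ) ^ 2 ≤ 4 * (b * m - 1) := by
  have hσγ : 0 < (σ + 1) * γ := mul_pos hσ hγ
  rcases le_total 1 m with h1 | h1
  · exact ⟨0, le_rfl, by linarith, by linarith⟩
  · refine ⟨(1 - m) / ((σ + 1) * γ), div_nonneg (by linarith) hσγ.le,
      (mul_div_cancel₀ _ hσγ.ne').ge, ?_⟩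
    rw [div_mul_eq_mul_div, div_le_iff₀ hσγ]
    linarith

theorem gammaPoly_eq {σ r b m : ℝ}
    (hm : b * (b + σ - 1) ^ 2 - 4 * σ * (σ * b + b - b ^ 2) = σ ^ 2 * (r - 1) * (4 - b * m))
    (γ : ℝ) :
    gammaPoly σ r b γ = σ ^ 2 * (r - 1) * b *
      ((2 * σ - b + γ) ^ 2 * (1 - m) - 4 * γ * (σ + 1) * (b * m - 1)) := by
  rw [gammaPoly, hm]
  ring

theorem gammaPoly_nonpos {σ r b γ : ℝ} (hσ : 0 < σ) (hb : 0 ≤ b) (hγ : 0 ≤ γ)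
    (hr : r - 1 ≥ (b * (b + σ - 1) ^ 2 - 4 * σ * (b + σ * b - b ^ 2)) / (3 * σ ^ 2))
    (h : σ ^ 2 * (r - 1) * (b - 4) ≤
      4 * σ * (σ * b + b - b ^ 2) - b * (b + σ - 1) ^ 2) : gammaPoly σ r b γ ≤ 0 := by
  rw [ge_iff_le, div_le_iff₀ (by positivity)] at hr
  exact add_nonpos (mul_nonpos_of_nonneg_of_nonpos (by positivity) (by linarith))
    (mul_nonpos_of_nonneg_of_nonpos (by positivity) (by linarith))

theorem exists_lorenzLyapunov_of_coeff {σ r b γ m g : ℝ} (hσ : σ ≠ 0) (hb : b ≠ 0)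
    (hm : b * (b + σ - 1) ^ 2 - 4 * σ * (σ * b + b - b ^ 2) = σ ^ 2 * (r - 1) * (4 - b * m))
    (hg : 0 ≤ g) (hR : 1 - m ≤ (σ + 1) * γ * g)
    (hz : g * (2 * σ - b + γ) ^ 2 ≤ 4 * (b * m - 1)) :
    ∃ V : EuclideanSpace ℝ (Fin 3) → ℝ, Differentiable ℝ V ∧
      ∀ p, fderiv ℝ V p (lorenzField σ r b p) + lorenzExcess σ r b p ≤ 0 := by
  set R := 1 - m - (σ + 1) * γ * g with hRdef
  -- `c₁` cancels the term linear in `z`, `c₂` and `c₃` turn the terms in `x ^ 2`, `x * y`, `y ^ 2`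
  -- into a multiple of `(y - x) ^ 2`.
  refine ⟨lorenzLyapunov σ (-4 * σ * lorenzScaleSq σ r b / b)
    ((((b - 1) / σ) ^ 2 - r * γ * g - R) / (2 * σ)) ((m + γ * g) / 2) (-γ * g) g,
    differentiable_lorenzLyapunov _ _ _ _ _ _, fun p => ?_⟩
  have hκ : 4 * σ * lorenzScaleSq σ r b / b = (r - 1) * m + (1 + (b - 1) / σ) ^ 2 := by
    rw [lorenzScaleSq]
    field_simp
    linear_combination -hm
  calc fderiv ℝ _ p (lorenzField σ r b p) + lorenzExcess σ r b p
      = R * (p 1 - p 0) ^ 2 - g * (p 0 ^ 2 - (γ + 2 * σ + b) / 2 * p 2) ^ 2 -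
          (b * m - 1 - g * (2 * σ - b + γ) ^ 2 / 4) * p 2 ^ 2 := by
        rw [fderiv_lorenzLyapunov_lorenzField hσ, lorenzExcess]
        have hc₁ : b * (-4 * σ * lorenzScaleSq σ r b / b) = -4 * σ * lorenzScaleSq σ r b := by
          field_simp
        have hc₂ : 2 * σ * ((((b - 1) / σ) ^ 2 - r * γ * g - R) / (2 * σ)) =
            ((b - 1) / σ) ^ 2 - r * γ * g - R := by
          field_simp
        linear_combination -p 2 * hc₁ + (p 0 * p 1 - p 0 ^ 2) * hc₂ - p 0 * p 1 * hκ +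
          2 * p 0 * p 1 * hRdef
    _ ≤ 0 := by
        have hR' : R * (p 1 - p 0) ^ 2 ≤ 0 :=
          mul_nonpos_of_nonpos_of_nonneg (by linarith) (sq_nonneg _)
        have hx : 0 ≤ g * (p 0 ^ 2 - (γ + 2 * σ + b) / 2 * p 2) ^ 2 := by positivity
        have hz' : 0 ≤ (b * m - 1 - g * (2 * σ - b + γ) ^ 2 / 4) * p 2 ^ 2 :=
          mul_nonneg (by linarith) (sq_nonneg _)
        linarith

theorem exists_lorenzLyapunov {σ r b γ : ℝ} (hσ : 0 < σ) (hb : 0 < b) (hr1 : 1 < r)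
    (hr2 : r - 1 ≥ (b * (b + σ - 1) ^ 2 - 4 * σ * (b + σ * b - b ^ 2)) / (3 * σ ^ 2))
    (hγ : 0 < γ) (hγ' : gammaPoly σ r b γ ≤ 0) :
    ∃ V : EuclideanSpace ℝ (Fin 3) → ℝ, Differentiable ℝ V ∧
      ∀ p, fderiv ℝ V p (lorenzField σ r b p) + lorenzExcess σ r b p ≤ 0 := by
  have hD : 0 < σ ^ 2 * (r - 1) := mul_pos (by positivity) (by linarith)
  obtain ⟨m, hm⟩ : ∃ m, b * (b + σ - 1) ^ 2 - 4 * σ * (σ * b + b - b ^ 2) =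
      σ ^ 2 * (r - 1) * (4 - b * m) := by
    refine ⟨(4 - (b * (b + σ - 1) ^ 2 - 4 * σ * (σ * b + b - b ^ 2)) / (σ ^ 2 * (r - 1))) / b, ?_⟩
    rw [mul_div_cancel₀ _ hb.ne', sub_sub_cancel, mul_div_cancel₀ _ hD.ne']
  have hbm : 1 ≤ b * m := by
    rw [ge_iff_le, div_le_iff₀ (by positivity)] at hr2
    have : 4 - b * m ≤ 3 := le_of_mul_le_mul_left (by linarith) hD
    linarith
  have hquad : (2 * σ - b + γ) ^ 2 * (1 - m) ≤ 4 * γ * (σ + 1) * (b * m - 1) := by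
    rw [gammaPoly_eq hm] at hγ'
    exact sub_nonpos.1 (nonpos_of_mul_nonpos_right hγ' (mul_pos hD hb))
  obtain ⟨g, hg, hR, hz⟩ := exists_lorenzLyapunov_coeff (by linarith) hγ hquad hbm
  exact exists_lorenzLyapunov_of_coeff hσ.ne' hb.ne' hm hg hR hz

/-! ### The Lyapunov dimension of the Lorenz system -/

section LorenzDimension

variable {σ r b : ℝ}

theorem lorenzScaleSq_pos (hσ : 0 < σ) (hb : 0 < b) (h : σ * r > (b + 1) * (b + σ)) :
    0 < lorenzScaleSq σ r b := by
  refine div_pos ?_ (by positivity)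
  linarith [mul_pos hb hσ]

theorem add_lt_lorenzGap (h : σ * r > (b + 1) * (b + σ)) : σ + 1 + 2 * b < lorenzGap σ r :=
  Real.lt_sqrt_of_sq_lt (by linarith)

theorem trace_fderiv_lorenzField (σ r b : ℝ) (p : EuclideanSpace ℝ (Fin 3)) :
    LinearMap.trace ℝ (EuclideanSpace ℝ (Fin 3)) (fderiv ℝ (lorenzField σ r b) p) =
      -(σ + b + 1) := by
  rw [(hasFDerivAt_lorenzField σ r b p).fderiv, trace_lorenzJacobian]

theorem localLyapunovDim_lorenzField_le (hσ : 0 < σ) (hb : 0 < b)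
    (hκ : 0 < lorenzScaleSq σ r b) (hgap : σ + 1 + 2 * b < lorenzGap σ r)
    {V : EuclideanSpace ℝ (Fin 3) → ℝ} (hV : Differentiable ℝ V)
    (hV' : ∀ p, fderiv ℝ V p (lorenzField σ r b p) + lorenzExcess σ r b p ≤ 0)
    (x₀ : EuclideanSpace ℝ (Fin 3)) :
    localLyapunovDim (lorenzField σ r b) x₀ ≤
      ((2 + 1 - (σ + b + 1) / ((σ + 1 + lorenzGap σ r) / 2) : ℝ) : EReal) := by
  have hG : 0 < lorenzGap σ r := by linarith
  refine localLyapunovDim_le (n := 2) (by positivity) (by linarith)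
    (trace_fderiv_lorenzField σ r b) fun X hX => ?_
  refine hX.exists_exp_mul_norm_le
    (fun u hu => isBounded_image_of_isForwardSolution_lorenzField hσ hb hu)
    (hV.const_mul (2 * lorenzGap σ r * lorenzScaleSq σ r b)⁻¹)
    (lorenzSymmetrizer_injective hκ) fun p v => ?_
  rw [(hasFDerivAt_lorenzField σ r b p).fderiv]
  refine le_trans ?_ (neg_mul_norm_sq_le_inner_lorenzSymmetrizer hσ.ne' hκ hG p v)
  rw [fderiv_const_mul (hV p), smul_apply, smul_eq_mul, inv_mul_eq_div]
  gcongr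
  have hsum : (fderiv ℝ V p (lorenzField σ r b p) + lorenzExcess σ r b p) /
      (2 * lorenzGap σ r * lorenzScaleSq σ r b) ≤ 0 :=
    div_nonpos_of_nonpos_of_nonneg (hV' p) (by positivity)
  rw [add_div] at hsum
  linarith

theorem le_localLyapunovDim_lorenzField_zero (hσ : 0 < σ) (hb : 0 < b)
    (hgap : σ + 1 + 2 * b < lorenzGap σ r) :
    ((2 + 1 - (σ + b + 1) / ((σ + 1 + lorenzGap σ r) / 2) : ℝ) : EReal) ≤
      localLyapunovDim (lorenzField σ r b) 0 := by
  have hG : 0 < lorenzGap σ r := by linarith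
  obtain ⟨v, hv, heigen⟩ := exists_eigenvector_lorenzJacobian_zero (r := r) b
    (Λ := (σ + 1 + lorenzGap σ r) / 2) hσ.ne' (by linarith [sq_lorenzGap hG])
  exact le_localLyapunovDim_of_eigenvector (n := 2) (lorenzField_zero σ r b) (by positivity)
    (by linarith) (trace_fderiv_lorenzField σ r b 0) hv
    ((hasFDerivAt_lorenzField σ r b 0).fderiv.symm ▸ heigen)

end LorenzDimension

theorem IsGlobalAttractor.mem_of_eq_zero {n : ℕ}
    {f : EuclideanSpace ℝ (Fin n) → EuclideanSpace ℝ (Fin n)} {K : Set (EuclideanSpace ℝ (Fin n))}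
    (hK : IsGlobalAttractor f K) {p : EuclideanSpace ℝ (Fin n)} (hp : f p = 0) : p ∈ K := by
  rw [hK.closed.mem_iff_infDist_zero hK.nonempty]
  exact tendsto_nhds_unique tendsto_const_nhds
    (hK.attractive _ fun t _ => hp ▸ hasDerivWithinAt_const t _ p)

theorem theorem4_general {σ r b γ : ℝ} (hσ : 0 < σ) (hb : 0 < b)
    (hr : r - 1 ≥ (b * (b + σ - 1) ^ 2 - 4 * σ * (b + σ * b - b ^ 2)) / (3 * σ ^ 2))
    (hγ : 0 < γ) (hγ' : gammaPoly σ r b γ ≤ 0) (hσr : σ * r > (b + 1) * (b + σ))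
    {K : Set (EuclideanSpace ℝ (Fin 3))} (hK : 0 ∈ K) :
    lyapunovDim (lorenzField σ r b) K =
      ((3 - 2 * (σ + b + 1) / (σ + 1 + √((σ - 1) ^ 2 + 4 * σ * r)) : ℝ) : EReal) := by
  have hκ := lorenzScaleSq_pos hσ hb hσr
  have hgap := add_lt_lorenzGap hσr
  have hr1 : 1 < r := lt_of_mul_lt_mul_left (by nlinarith) hσ.le
  obtain ⟨V, hV, hV'⟩ := exists_lorenzLyapunov hσ hb hr1 hr hγ hγ'
  have hdim : 3 - 2 * (σ + b + 1) / (σ + 1 + lorenzGap σ r) =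
      2 + 1 - (σ + b + 1) / ((σ + 1 + lorenzGap σ r) / 2) := by
    rw [← div_mul, mul_div_right_comm]
    ring
  rw [← lorenzGap, hdim]
  exact le_antisymm
    (iSup₂_le fun x₀ _ => localLyapunovDim_lorenzField_le hσ hb hκ hgap hV hV' x₀)
    (le_iSup₂_of_le 0 hK (le_localLyapunovDim_lorenzField_zero hσ hb hgap))

theorem theorem4 (σ r b : ℝ) (hσ : 0 < σ) (hr : 0 < r) (hb : 0 < b)
    (hr1 : r - 1 > 0)
    (hr2 : r - 1 ≥ (b * (b + σ - 1) ^ 2 - 4 * σ * (b + σ * b - b ^ 2)) / (3 * σ ^ 2))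
    (hab :
      (σ ^ 2 * (r - 1) * (b - 4) ≤ 4 * σ * (σ * b + b - b ^ 2) - b * (b + σ - 1) ^ 2) ∨
      (σ ^ 2 * (r - 1) * (b - 4) > 4 * σ * (σ * b + b - b ^ 2) - b * (b + σ - 1) ^ 2 ∧
        ∃ γ₁ γ₂ : ℝ, γ₁ < γ₂ ∧ gammaPoly σ r b γ₁ = 0 ∧ gammaPoly σ r b γ₂ = 0 ∧ 0 < γ₂))
    (hσr : σ * r > (b + 1) * (b + σ))
    (K : Set (EuclideanSpace ℝ (Fin 3))) (hK : IsGlobalAttractor (lorenzField σ r b) K) :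
    lyapunovDim (lorenzField σ r b) K =
      ((3 - 2 * (σ + b + 1) / (σ + 1 + √((σ - 1) ^ 2 + 4 * σ * r)) : ℝ) : EReal) := by
  obtain ⟨γ, hγ, hγ'⟩ : ∃ γ, 0 < γ ∧ gammaPoly σ r b γ ≤ 0 := hab.elim
    (fun h => ⟨1, one_pos, gammaPoly_nonpos hσ hb.le zero_le_one hr2 h⟩)
    (fun ⟨_, _, γ, _, _, hγ, hpos⟩ => ⟨γ, hpos, hγ.le⟩)
  exact theorem4_general hσ hb hr2 hγ hγ' hσr (hK.mem_of_eq_zero (lorenzField_zero σ r b))
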